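/- Let $k\ge 1$ be an integer; all algebras are associative, unital and over $\mathbb C$, and a superalgebra is a $\mathbb Z/2\mathbb Z$-graded algebra. Let $\mathcal A_k$ be the superalgebra generated by elements $\gamma_1,\dots,\gamma_{k-1}$ of degree $1$ with relations $\gamma_i^2=-1$ for all $i$, $(\gamma_i\gamma_{i+1})^3=-1$ for $1\le i\le k-2$, and $(\gamma_i\gamma_j)^2=-1$ for $|i-j|\ge 2$ (a twisted group algebra of the symmetric group $S_k$). Let $\mathcal B_k$ be the superalgebra generated by an element $\tau$ of degree $1$ and elements $\sigma_1,\dots,\sigma_{k-1}$ of degree $0$ with relations $\tau^2=\sigma_i^2=1$ for all $i$, $(\sigma_i\sigma_{i+1})^3=1$ for $1\le i\le k-2$, $(\sigma_i\sigma_j)^2=1$ for $|i-j|\ge 2$, $(\tau\sigma_i)^2=1$ for $2\le i\le k-1$, and, if $k\ge 2$, $(\tau\sigma_1)^4=-1$ (a twisted group algebra of the hyperoctahedral group). Put $\tau_i=\sigma_{i-1}\cdots\sigma_1\tau\sigma_1\cdots\sigma_{i-1}$ for $1\le i\le k$. Let $\mathcal C_k$ be the Clifford algebra of the quadratic form $x_1^2+\cdots+x_k^2$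 on $\mathbb C^k$, that is, the superalgebra generated by elements $\xi_1,\dots,\xi_k$ of degree $1$ with relations $\xi_i^2=1$ and $\xi_i\xi_j=-\xi_j\xi_i$ for $i\ne j$. For superalgebras $A,B$ let $A\mathbin{\dot\otimes}B$ be the vector space $A\otimes B$ with the multiplication $(a\otimes b)(c\otimes d)=(-1)^{\beta\delta}\,ac\otimes bd$ for $b\in B_\beta$, $c\in A_\delta$, and the grading $(A\mathbin{\dot\otimes}B)_\alpha=\bigoplus_{\beta+\delta=\alpha}A_\beta\otimes B_\delta$. **Theorem 3.2.** There is exactly one algebra homomorphism $\vartheta:\mathcal C_k\mathbin{\dot\otimes}\mathcal A_k\to\mathcal B_k$ satisfying $$\vartheta(\xi_i\otimes 1)=\tau_i\quad(1\le i\le k),\qquad \vartheta(1\otimes\gamma_j)=\tfrac1{\sqrt2}(\tau_j-\tau_{j+1})\sigma_j\quad(1\le j\le k-1),$$ and $\vartheta$ is an isomorphism of superalgebras: it is bijective and maps the degree $\alpha$ part of $\mathcal C_k\mathbin{\dot\otimes}\mathcal A_k$ onto the degree $\alpha$ part of $\mathcal B_k$ for each $\alpha\in\mathbb Z/2\mathbb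 Z$. -/

import Mathlib

open scoped TensorProduct

noncomputable section

namespace TwistedDuality

/-! ### Gradings determined by the degrees of generators -/

/-- Given elements `g x` of an algebra `A` over `ℂ` and degrees `d x` in `ℤ/2`, the subspace of
`A` spanned by the words `g x₁ * ⋯ * g xₘ` with `d x₁ + ⋯ + d xₘ = α`. If the `g x` generate `A`
and the defining relations are homogeneous, this is the degree `α` part of the grading of `A`
in which every generator `g x` has degree `d x`. -/
def wordGrading {A X : Type} [Ring A] [Algebra ℂ A] (g : X → A) (d : X → ZMod 2) (α : ZMod 2) :
    Submodule ℂ A :=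
  Submodule.span ℂ {a | ∃ l : List X, (l.map d).sum = α ∧ a = (l.map g).prod}

section wordGrading

variable {A X : Type} [Ring A] [Algebra ℂ A] (g : X → A) (d : X → ZMod 2)

theorem gen_mem_wordGrading (x : X) : g x ∈ wordGrading g d (d x) :=
  Submodule.subset_span ⟨[x], by simp, by simp⟩

theorem wordGrading_gradedMonoid : SetLike.GradedMonoid (wordGrading g d) where
  one_mem := Submodule.subset_span ⟨[], by simp, by simp⟩
  mul_mem := by
    intro i j a b ha hb
    have h : wordGrading g d i * wordGrading g d j ≤ wordGrading g d (i + j) := by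
      unfold wordGrading
      rw [Submodule.span_mul_span, Submodule.span_le]
      rintro _ ⟨_, ⟨l, hl, rfl⟩, _, ⟨m, hm, rfl⟩, rfl⟩
      exact Submodule.subset_span ⟨l ++ m, by simp [hl, hm], by simp⟩
    exact h (Submodule.mul_mem_mul ha hb)

theorem iSup_wordGrading (hg : Algebra.adjoin ℂ (Set.range g) = ⊤) :
    ⨆ α, wordGrading g d α = ⊤ := by
  rw [eq_top_iff, ← Algebra.top_toSubmodule, ← hg, Algebra.adjoin_eq_span, Submodule.span_le]
  intro a ha
  have : ∃ l : List X, a = (l.map g).prod := by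
    induction ha using Submonoid.closure_induction with
    | mem a h => obtain ⟨x, rfl⟩ := h; exact ⟨[x], by simp⟩
    | one => exact ⟨[], by simp⟩
    | mul a b _ _ h₁ h₂ =>
      obtain ⟨l, rfl⟩ := h₁
      obtain ⟨m, rfl⟩ := h₂
      exact ⟨l ++ m, by simp⟩
  obtain ⟨l, rfl⟩ := this
  exact Submodule.mem_iSup_of_mem (l.map d).sum (Submodule.subset_span ⟨l, rfl, rfl⟩)

/-- The grading by words is a direct sum decomposition as soon as the parity map on the generators
extends to an endomorphism of the algebra. -/
theorem wordGrading_isInternal (hg : Algebra.adjoin ℂ (Set.range g) = ⊤)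
    (θ : A →ₐ[ℂ] A) (hθ : ∀ x, θ (g x) = if d x = 0 then g x else -g x) :
    DirectSum.IsInternal (wordGrading g d) := by
  have key : ∀ α : ZMod 2, ∀ a ∈ wordGrading g d α, θ a = if α = 0 then a else -a := by
    intro α a ha
    induction ha using Submodule.span_induction with
    | mem a h =>
      obtain ⟨l, rfl, rfl⟩ := h
      induction l with
      | nil => simp
      | cons x l ih =>
        have two : ∀ a b : ZMod 2, (a + b = 0) ↔ (a = 0 ↔ b = 0) := by decide
        simp only [List.map_cons, List.prod_cons, List.sum_cons, map_mul, hθ, ih, two]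
        by_cases h₁ : d x = 0 <;> by_cases h₂ : (l.map d).sum = 0 <;> simp [h₁, h₂]
    | zero => simp
    | add a b _ _ h₁ h₂ =>
      rw [map_add, h₁, h₂]
      split_ifs
      · rfl
      · rw [neg_add]
    | smul c a _ h =>
      rw [map_smul, h]
      split_ifs
      · rfl
      · rw [smul_neg]
  rw [DirectSum.isInternal_submodule_iff_isCompl (wordGrading g d) (i := 0) (j := 1) (by decide)
    (by ext x; revert x; simp; decide)]
  constructor
  · rw [Submodule.disjoint_def]
    intro a h₀ h₁
    have e₀ := key 0 a h₀
    have e₁ := key 1 a h₁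
    rw [if_pos rfl] at e₀
    rw [if_neg (by decide), e₀] at e₁
    have h2 : (2 : ℂ) • a = 0 := by
      rw [two_smul]
      nth_rewrite 1 [e₁]
      simp
    exact (smul_eq_zero.mp h2).resolve_left two_ne_zero
  · rw [codisjoint_iff, eq_top_iff, ← iSup_wordGrading g d hg]
    refine iSup_le fun α => ?_
    fin_cases α
    · exact le_sup_left
    · exact le_sup_right

/-- The graded algebra structure on the grading by words. -/
@[reducible]
def wordGradedAlgebra (hg : Algebra.adjoin ℂ (Set.range g) = ⊤)
    (θ : A →ₐ[ℂ] A) (hθ : ∀ x, θ (g x) = if d x = 0 then g x else -g x) :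
    GradedAlgebra (wordGrading g d) :=
  { wordGrading_gradedMonoid g d,
    (wordGrading_isInternal g d hg θ hθ).chooseDecomposition with }

end wordGrading

theorem adjoin_range_mkAlgHom {X : Type} (r : FreeAlgebra ℂ X → FreeAlgebra ℂ X → Prop) :
    Algebra.adjoin ℂ (Set.range fun x => RingQuot.mkAlgHom ℂ r (FreeAlgebra.ι ℂ x)) = ⊤ := by
  have h : (Set.range fun x => RingQuot.mkAlgHom ℂ r (FreeAlgebra.ι ℂ x))
      = RingQuot.mkAlgHom ℂ r '' Set.range (FreeAlgebra.ι ℂ) := by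
    rw [← Set.range_comp]; rfl
  rw [h, ← AlgHom.map_adjoin, FreeAlgebra.adjoin_range_ι, Algebra.map_top, AlgHom.range_eq_top]
  exact RingQuot.mkAlgHom_surjective ℂ r

/-! ### The twisted group algebra of the symmetric group

Throughout, `n = k - 1` where `k ≥ 1` is the degree of the symmetric group, and indices start
at `0`: the generators `γ_1, …, γ_{k-1}` are indexed by `Fin n`. -/

/-- The defining relations of `𝓐_{n+1}`. -/
inductive ARel (n : ℕ) : FreeAlgebra ℂ (Fin n) → FreeAlgebra ℂ (Fin n) → Prop
  | sq (i : Fin n) : ARel n (FreeAlgebra.ι ℂ i ^ 2) (-1)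
  | braid (i j : Fin n) (h : (i : ℕ) + 1 = j) :
      ARel n ((FreeAlgebra.ι ℂ i * FreeAlgebra.ι ℂ j) ^ 3) (-1)
  | far (i j : Fin n) (h : (i : ℕ) + 2 ≤ j ∨ (j : ℕ) + 2 ≤ i) :
      ARel n ((FreeAlgebra.ι ℂ i * FreeAlgebra.ι ℂ j) ^ 2) (-1)

/-- The algebra `𝓐_k`, `k = n + 1`: the twisted group algebra of the symmetric group of
degree `k`, given by generators and relations over `ℂ`. -/
def AAlg (n : ℕ) : Type := RingQuot (ARel n)

instance (n : ℕ) : Ring (AAlg n) := inferInstanceAs (Ring (RingQuot (ARel n)))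

instance (n : ℕ) : Algebra ℂ (AAlg n) := inferInstanceAs (Algebra ℂ (RingQuot (ARel n)))

/-- The quotient map from the free algebra. -/
def mkA (n : ℕ) : FreeAlgebra ℂ (Fin n) →ₐ[ℂ] AAlg n := RingQuot.mkAlgHom ℂ (ARel n)

theorem mkA_rel {n : ℕ} {x y : FreeAlgebra ℂ (Fin n)} (h : ARel n x y) : mkA n x = mkA n y :=
  RingQuot.mkAlgHom_rel ℂ h

/-- The universal property of the presentation. -/
def liftA {n : ℕ} {D : Type} [Ring D] [Algebra ℂ D] (f : FreeAlgebra ℂ (Fin n) →ₐ[ℂ] D)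
    (hf : ∀ ⦃x y⦄, ARel n x y → f x = f y) : AAlg n →ₐ[ℂ] D :=
  RingQuot.liftAlgHom ℂ ⟨f, hf⟩

theorem liftA_mkA {n : ℕ} {D : Type} [Ring D] [Algebra ℂ D] (f : FreeAlgebra ℂ (Fin n) →ₐ[ℂ] D)
    (hf : ∀ ⦃x y⦄, ARel n x y → f x = f y) (x : FreeAlgebra ℂ (Fin n)) :
    liftA f hf (mkA n x) = f x :=
  RingQuot.liftAlgHom_mkAlgHom_apply ℂ _ _ _

/-- The generators of `𝓐_{n+1}`. -/
def γ {n : ℕ} (i : Fin n) : AAlg n := mkA n (FreeAlgebra.ι ℂ i)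

/-- The grading of `𝓐_{n+1}` in which all generators have degree `1`. -/
def gradA (n : ℕ) : ZMod 2 → Submodule ℂ (AAlg n) :=
  wordGrading γ (fun _ => 1)

/-- The parity automorphism of `𝓐_{n+1}`. -/
def parityA (n : ℕ) : AAlg n →ₐ[ℂ] AAlg n :=
  liftA (FreeAlgebra.lift ℂ fun i => -γ i) (by
    intro x y h
    have e := mkA_rel h
    cases h <;> simp only [map_pow, map_mul, map_neg, map_one, FreeAlgebra.lift_ι_apply,
      neg_mul_neg, neg_sq] at e ⊢ <;> exact e)

theorem parityA_γ {n : ℕ} (i : Fin n) : parityA n (γ i) = -γ i :=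
  (liftA_mkA _ _ _).trans (FreeAlgebra.lift_ι_apply _ _)

instance (n : ℕ) : GradedAlgebra (gradA n) :=
  wordGradedAlgebra γ (fun _ => 1) (adjoin_range_mkAlgHom (ARel n)) (parityA n)
    (fun i => by simp [parityA_γ])

/-! ### The twisted group algebra of the hyperoctahedral group -/

/-- Symbols for the generators `τ` and `σ_1, …, σ_{k-1}` of `𝓑_k`, `k = n + 1`. -/
inductive BGen (n : ℕ) : Type
  | tau : BGen n
  | sigma (i : Fin n) : BGen n

/-- The defining relations of `𝓑_{n+1}`. -/
inductive BRel (n : ℕ) : FreeAlgebra ℂ (BGen n) → FreeAlgebra ℂ (BGen n) → Prop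
  | tau_sq : BRel n (FreeAlgebra.ι ℂ .tau ^ 2) 1
  | sigma_sq (i : Fin n) : BRel n (FreeAlgebra.ι ℂ (.sigma i) ^ 2) 1
  | braid (i j : Fin n) (h : (i : ℕ) + 1 = j) :
      BRel n ((FreeAlgebra.ι ℂ (.sigma i) * FreeAlgebra.ι ℂ (.sigma j)) ^ 3) 1
  | far (i j : Fin n) (h : (i : ℕ) + 2 ≤ j ∨ (j : ℕ) + 2 ≤ i) :
      BRel n ((FreeAlgebra.ι ℂ (.sigma i) * FreeAlgebra.ι ℂ (.sigma j)) ^ 2) 1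
  | tau_sigma (i : Fin n) (h : 1 ≤ (i : ℕ)) :
      BRel n ((FreeAlgebra.ι ℂ .tau * FreeAlgebra.ι ℂ (.sigma i)) ^ 2) 1
  | tau_sigma_first (i : Fin n) (h : (i : ℕ) = 0) :
      BRel n ((FreeAlgebra.ι ℂ .tau * FreeAlgebra.ι ℂ (.sigma i)) ^ 4) (-1)

/-- The algebra `𝓑_k`, `k = n + 1`: the twisted group algebra of the hyperoctahedral group of
rank `k`, given by generators and relations over `ℂ`. -/
def BAlg (n : ℕ) : Type := RingQuot (BRel n)

instance (n : ℕ) : Ring (BAlg n) := inferInstanceAs (Ring (RingQuot (BRel n)))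

instance (n : ℕ) : Algebra ℂ (BAlg n) := inferInstanceAs (Algebra ℂ (RingQuot (BRel n)))

/-- The quotient map from the free algebra. -/
def mkB (n : ℕ) : FreeAlgebra ℂ (BGen n) →ₐ[ℂ] BAlg n := RingQuot.mkAlgHom ℂ (BRel n)

theorem mkB_rel {n : ℕ} {x y : FreeAlgebra ℂ (BGen n)} (h : BRel n x y) : mkB n x = mkB n y :=
  RingQuot.mkAlgHom_rel ℂ h

/-- The universal property of the presentation. -/
def liftB {n : ℕ} {D : Type} [Ring D] [Algebra ℂ D] (f : FreeAlgebra ℂ (BGen n) →ₐ[ℂ] D)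
    (hf : ∀ ⦃x y⦄, BRel n x y → f x = f y) : BAlg n →ₐ[ℂ] D :=
  RingQuot.liftAlgHom ℂ ⟨f, hf⟩

theorem liftB_mkB {n : ℕ} {D : Type} [Ring D] [Algebra ℂ D] (f : FreeAlgebra ℂ (BGen n) →ₐ[ℂ] D)
    (hf : ∀ ⦃x y⦄, BRel n x y → f x = f y) (x : FreeAlgebra ℂ (BGen n)) :
    liftB f hf (mkB n x) = f x :=
  RingQuot.liftAlgHom_mkAlgHom_apply ℂ _ _ _

/-- The images in `𝓑_{n+1}` of the generating symbols. -/
def genB {n : ℕ} (x : BGen n) : BAlg n := mkB n (FreeAlgebra.ι ℂ x)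

/-- The generators `σ_1, …, σ_{k-1}` of `𝓑_k`, `k = n + 1`. -/
def σ {n : ℕ} (i : Fin n) : BAlg n := genB (.sigma i)

/-- The elements `τ_i = σ_{i-1} ⋯ σ_1 τ σ_1 ⋯ σ_{i-1}` of `𝓑_k` for `1 ≤ i ≤ k`, where
`k = n + 1`; with indices from `0`, `τ_0 = τ` and `τ_{i+1} = σ_i τ_i σ_i`. -/
def τ {n : ℕ} (i : Fin (n + 1)) : BAlg n :=
  Fin.induction (motive := fun _ => BAlg n) (genB .tau) (fun i t => σ i * t * σ i) i

/-- The degrees of the generators of `𝓑_{n+1}`: `τ` is odd and the `σ_i` are even. -/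
def degB {n : ℕ} : BGen n → ZMod 2
  | .tau => 1
  | .sigma _ => 0

/-- The grading of `𝓑_{n+1}` in which `τ` has degree `1` and the `σ_i` have degree `0`. -/
def gradB (n : ℕ) : ZMod 2 → Submodule ℂ (BAlg n) :=
  wordGrading genB degB

/-- The parity automorphism of `𝓑_{n+1}`. -/
def parityB (n : ℕ) : BAlg n →ₐ[ℂ] BAlg n :=
  liftB (FreeAlgebra.lift ℂ fun x => if degB x = 0 then genB x else -genB x) (by
    intro x y h
    have e := mkB_rel h
    cases h <;> simp only [map_pow, map_mul, map_neg, map_one, FreeAlgebra.lift_ι_apply, degB,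
      neg_mul, neg_sq, Even.neg_pow (show Even 4 by decide), one_ne_zero, if_true,
      if_false] at e ⊢ <;> exact e)

theorem parityB_genB {n : ℕ} (x : BGen n) :
    parityB n (genB x) = if degB x = 0 then genB x else -genB x :=
  (liftB_mkB _ _ _).trans (FreeAlgebra.lift_ι_apply _ _)

instance (n : ℕ) : GradedAlgebra (gradB n) :=
  wordGradedAlgebra genB degB (adjoin_range_mkAlgHom (BRel n)) (parityB n) parityB_genB

/-! ### The Clifford algebra -/

/-- The quadratic form `v ↦ v_1 ^ 2 + ⋯ + v_k ^ 2` on `ℂ^k`. -/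
def sumSq (k : ℕ) : QuadraticForm ℂ (Fin k → ℂ) :=
  QuadraticMap.weightedSumSquares ℂ (fun _ : Fin k => (1 : ℂ))

/-- The Clifford algebra `𝓒_k` over `ℂ`, graded by Mathlib's `CliffordAlgebra.evenOdd`. -/
abbrev CAlg (k : ℕ) : Type := CliffordAlgebra (sumSq k)

/-- The grading of `𝓒_k`; the generators `ξ_i` have degree `1`. -/
abbrev gradC (k : ℕ) : ZMod 2 → Submodule ℂ (CAlg k) := CliffordAlgebra.evenOdd (sumSq k)

/-- The generators `ξ_1, …, ξ_k` of `𝓒_k`: the images of the standard basis vectors. -/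
def ξ {k : ℕ} (i : Fin k) : CAlg k := CliffordAlgebra.ι (sumSq k) (Pi.single i 1)

theorem ξ_sq {k : ℕ} (i : Fin k) : ξ i ^ 2 = 1 := by
  rw [sq, ξ, CliffordAlgebra.ι_sq_scalar]
  have h : sumSq k (Pi.single i 1) = 1 := by
    simp [sumSq, QuadraticMap.weightedSumSquares_apply, Pi.single_apply]
  rw [h, map_one]

theorem ξ_mul_ξ {k : ℕ} {i j : Fin k} (h : i ≠ j) : ξ i * ξ j = -(ξ j * ξ i) := by
  refine CliffordAlgebra.ι_mul_ι_comm_of_isOrtho ?_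
  simp only [QuadraticMap.IsOrtho, sumSq, QuadraticMap.weightedSumSquares_apply, Pi.add_apply,
    ← Finset.sum_add_distrib]
  refine Finset.sum_congr rfl fun l _ => ?_
  by_cases hi : l = i
  · subst hi; simp [h]
  · simp [hi]

/-! ### The supertensor product

The algebra is Mathlib's graded tensor product `𝒜 ᵍ⊗[ℂ] ℬ`, in which
`(a ⊗ b) (c ⊗ d) = (-1) ^ (deg b * deg c) ac ⊗ bd`. -/

/-- The grading of the supertensor product: the degree `α` part is the sum of the subspaces
`A_β ⊗ B_δ` with `β + δ = α`. -/
def superTensorGrading {A B : Type} [Ring A] [Ring B] [Algebra ℂ A] [Algebra ℂ B]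
    (𝒜 : ZMod 2 → Submodule ℂ A) (ℬ : ZMod 2 → Submodule ℂ B)
    [GradedAlgebra 𝒜] [GradedAlgebra ℬ] (α : ZMod 2) : Submodule ℂ (𝒜 ᵍ⊗[ℂ] ℬ) :=
  Submodule.span ℂ {x | ∃ β δ : ZMod 2, β + δ = α ∧ ∃ a ∈ 𝒜 β, ∃ b ∈ ℬ δ, x = a ᵍ⊗ₜ[ℂ] b}

end TwistedDuality

end

/-! The point is that `ϑ` has an explicit inverse. In `𝓑` the `τ i` are anticommuting involutions,
hence a copy of the Clifford generators, and conjugation by `σ j` swaps `τ j.castSucc` with `τ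
j.succ` and fixes the others. The root vector d = `τ j.castSucc - τ j.succ` satisfies d² = 2, and
conjugation by it performs the same swap followed by a sign change of all the `τ i` outside the span
of the two; on the pair the sign also appears. So `twistB j` = dσ/√2 induces no permutation and
anticommutes with every `τ i` (`twistB_mul_τ`). It also satisfies the relations of `𝓐`, by a
computation with roots of norm 2 (`braid_mul_of_reflection`). The universal property of the
supertensor product then gives `toB`.

Since d² = 2, the formula inverts itself: σ = d · `twistB j` / √2. In the supertensor product the
elements `reflProd`, built by this recipe, satisfy the relations of the `σ j`
(`braid_mul_of_anticomm`, `reflProd_conj`), which gives `fromB`. The two maps are inverse to each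
other on generators, hence everywhere. Both send generators to homogeneous elements of the right
degree, so the gradings correspond; uniqueness holds because the generators generate. -/

noncomputable section

namespace TwistedDuality

/-! ### Word gradings: passing from generators to homogeneous elements -/

section Words

variable {A B D X Y : Type} [Ring A] [Algebra ℂ A] [Ring B] [Algebra ℂ B] [Ring D] [Algebra ℂ D]

theorem negOnePow_smul_comm {D : Type} [Ring D] {a b : D} {i : ZMod 2}
    (h : a * b = (-1 : ℤˣ) ^ i • (b * a)) : b * a = (-1 : ℤˣ) ^ i • (a * b) := by
  rw [h, smul_smul, Int.units_mul_self, one_smul]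

/-- Moving `z` past a word costs one sign per letter, and these multiply to the sign of the total
degree. -/
theorem map_wordGrading_supercommute (g : X → A) (d : X → ZMod 2) (f : A →ₐ[ℂ] D) (z : D)
    (j : ZMod 2) (H : ∀ x, f (g x) * z = (-1 : ℤˣ) ^ (d x * j) • (z * f (g x)))
    {i : ZMod 2} {a : A} (ha : a ∈ wordGrading g d i) :
    f a * z = (-1 : ℤˣ) ^ (i * j) • (z * f a) := by
  induction ha using Submodule.span_induction with
  | mem a h =>
    obtain ⟨l, rfl, rfl⟩ := h
    induction l with
    | nil => simp
    | cons x l ih =>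
      simp only [List.map_cons, List.prod_cons, List.sum_cons, map_mul]
      rw [mul_assoc, ih, mul_smul_comm, ← mul_assoc, H, smul_mul_assoc, smul_smul, ← uzpow_add,
        mul_assoc, add_mul, add_comm]
  | zero => simp
  | add a b _ _ h₁ h₂ => rw [map_add, add_mul, h₁, h₂, mul_add, smul_add]
  | smul c a _ h => rw [map_smul, smul_mul_assoc, h, mul_smul_comm, smul_comm]

/-- One-sided extension from letters to words, applied to each factor in turn. It reduces the
supercommutation needed to map out of a supertensor product to generators. -/
theorem wordGrading_supercommute (g : X → A) (d : X → ZMod 2) (h : Y → B) (e : Y → ZMod 2)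
    (f : A →ₐ[ℂ] D) (f' : B →ₐ[ℂ] D)
    (H : ∀ x y, f (g x) * f' (h y) = (-1 : ℤˣ) ^ (d x * e y) • (f' (h y) * f (g x)))
    {i j : ZMod 2} {a : A} (ha : a ∈ wordGrading g d i) {b : B} (hb : b ∈ wordGrading h e j) :
    f a * f' b = (-1 : ℤˣ) ^ (j * i) • (f' b * f a) := by
  refine negOnePow_smul_comm (map_wordGrading_supercommute h e f' (f a) i (fun y => ?_) hb)
  refine negOnePow_smul_comm ?_
  rw [mul_comm (e y)]
  exact map_wordGrading_supercommute g d f (f' (h y)) (e y) (fun x => H x y) ha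

theorem map_wordGrading_le (g : X → A) (d : X → ZMod 2) (f : A →ₐ[ℂ] D)
    (S : ZMod 2 → Submodule ℂ D) [SetLike.GradedMonoid S] (H : ∀ x, f (g x) ∈ S (d x))
    {i : ZMod 2} {a : A} (ha : a ∈ wordGrading g d i) : f a ∈ S i := by
  induction ha using Submodule.span_induction with
  | mem a h =>
    obtain ⟨l, rfl, rfl⟩ := h
    induction l with
    | nil => simpa using SetLike.GradedOne.one_mem
    | cons x l ih =>
      simp only [List.map_cons, List.prod_cons, List.sum_cons, map_mul]
      exact SetLike.mul_mem_graded (H x) ih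
  | zero => simp
  | add a b _ _ h₁ h₂ => rw [map_add]; exact add_mem h₁ h₂
  | smul c a _ h => rw [map_smul]; exact Submodule.smul_mem _ _ h

end Words

/-! ### Gradings of the Clifford algebra and of the supertensor product -/

theorem ι_eq_sum_ξ {k : ℕ} (v : Fin k → ℂ) :
    CliffordAlgebra.ι (sumSq k) v = ∑ i, v i • ξ i := by
  conv_lhs => rw [pi_eq_sum_univ' v]
  simp only [map_sum, map_smul, ξ]

/-- `evenOdd` is a supremum of powers of the range of `ι`, and that range is spanned by the `ξ i`.
This makes the word lemmas available for `𝓒`. -/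
theorem gradC_le_wordGrading {k : ℕ} {i : ZMod 2} {a : CAlg k} (ha : a ∈ gradC k i) :
    a ∈ wordGrading (ξ (k := k)) (fun _ => 1) i := by
  have := wordGrading_gradedMonoid (ξ (k := k)) (fun _ => 1)
  have hι : ∀ v, CliffordAlgebra.ι (sumSq k) v ∈ wordGrading (ξ (k := k)) (fun _ => 1) 1 :=
    fun v => by
      rw [ι_eq_sum_ξ]
      exact sum_mem fun i _ => Submodule.smul_mem _ _ (gen_mem_wordGrading ξ (fun _ => 1) i)
  have hpow : ∀ m : ℕ, LinearMap.range (CliffordAlgebra.ι (sumSq k)) ^ m ≤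
      wordGrading (ξ (k := k)) (fun _ => 1) (m : ZMod 2) := by
    intro m
    induction m with
    | zero =>
      rw [pow_zero, Submodule.one_le, Nat.cast_zero]
      exact SetLike.GradedOne.one_mem
    | succ m ih =>
      rw [pow_succ, Submodule.mul_le, Nat.cast_succ]
      rintro a ha _ ⟨v, rfl⟩
      exact SetLike.mul_mem_graded (ih ha) (hι v)
  unfold gradC CliffordAlgebra.evenOdd at ha
  refine (iSup_le ?_ : _ ≤ wordGrading (ξ (k := k)) (fun _ => 1) i) ha
  rintro ⟨m, rfl⟩
  exact hpow m

theorem superTensorGrading_gradedMonoid {A B : Type} [Ring A] [Ring B] [Algebra ℂ A] [Algebra ℂ B]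
    (𝒜 : ZMod 2 → Submodule ℂ A) (ℬ : ZMod 2 → Submodule ℂ B)
    [GradedAlgebra 𝒜] [GradedAlgebra ℬ] : SetLike.GradedMonoid (superTensorGrading 𝒜 ℬ) where
  one_mem := Submodule.subset_span ⟨0, 0, by simp, 1, SetLike.GradedOne.one_mem, 1,
    SetLike.GradedOne.one_mem, rfl⟩
  mul_mem := by
    intro i j x y hx hy
    have h : superTensorGrading 𝒜 ℬ i * superTensorGrading 𝒜 ℬ j ≤
        superTensorGrading 𝒜 ℬ (i + j) := by
      unfold superTensorGrading
      rw [Submodule.span_mul_span, Submodule.span_le]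
      rintro _ ⟨_, ⟨β, δ, rfl, a, ha, b, hb, rfl⟩, _, ⟨β', δ', rfl, a', ha', b', hb', rfl⟩, rfl⟩
      have e := GradedTensorProduct.tmul_coe_mul_coe_tmul (R := ℂ) 𝒜 ℬ a ⟨b, hb⟩ ⟨a', ha'⟩ b'
      simp only at e ⊢
      rw [e, SetLike.mem_coe]
      refine Submodule.smul_of_tower_mem _ _ (Submodule.subset_span ⟨β + β', δ + δ', by abel, _,
        SetLike.mul_mem_graded ha ha', _, SetLike.mul_mem_graded hb hb', rfl⟩)
    exact h (Submodule.mul_mem_mul hx hy)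

/-! ### Coxeter-type relations in an arbitrary ring -/

section Ring
variable {D : Type} [Ring D]

/-- Lets a two-letter relation rewrite inside a right-associated product. -/
theorem mul_reassoc {a b c : D} (h : a * b = c) (z : D) : a * (b * z) = c * z := by
  rw [← mul_assoc, h]

/-- Right multiplication by `b * a * b` collapses the six-letter word to `-(a * b * a)`, so the
signs cancel and the braid relation is untwisted. -/
theorem braid_of_pow_three_eq_neg_one {a b : D} (ha : a * a = -1) (hb : b * b = -1)
    (h : (a * b) ^ 3 = -1) : a * b * a = b * a * b := by
  have := congrArg (· * (b * a * b)) h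
  simpa [pow_succ, mul_assoc, ha, hb, mul_reassoc ha, mul_reassoc hb] using this

theorem braid_of_pow_three_eq_one {a b : D} (ha : a * a = 1) (hb : b * b = 1)
    (h : (a * b) ^ 3 = 1) : a * b * a = b * a * b := by
  have := congrArg (· * (b * a * b)) h
  simpa [pow_succ, mul_assoc, ha, hb, mul_reassoc ha, mul_reassoc hb] using this

theorem pow_three_eq_neg_one_of_braid {a b : D} (ha : a * a = -1) (hb : b * b = -1)
    (h : a * b * a = b * a * b) : (a * b) ^ 3 = -1 := by
  have e : (a * b) ^ 3 = (a * b * a) * (b * a * b) := by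
    simp only [pow_succ, pow_zero, one_mul, mul_assoc]
  rw [e, ← h]
  simp [mul_assoc, ha, mul_reassoc ha, mul_reassoc hb]

theorem pow_three_eq_one_of_braid {a b : D} (ha : a * a = 1) (hb : b * b = 1)
    (h : a * b * a = b * a * b) : (a * b) ^ 3 = 1 := by
  have e : (a * b) ^ 3 = (a * b * a) * (b * a * b) := by
    simp only [pow_succ, pow_zero, one_mul, mul_assoc]
  rw [e, ← h]
  simp [mul_assoc, ha, mul_reassoc ha, mul_reassoc hb]

theorem anticomm_of_sq_eq_neg_one {a b : D} (ha : a * a = -1) (hb : b * b = -1)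
    (h : (a * b) ^ 2 = -1) : a * b = -(b * a) := by
  have := congrArg (· * (b * a)) h
  simpa [pow_succ, mul_assoc, ha, hb, mul_reassoc ha, mul_reassoc hb] using this

theorem sq_eq_neg_one_of_anticomm {a b : D} (ha : a * a = -1) (hb : b * b = -1)
    (h : a * b = -(b * a)) : (a * b) ^ 2 = -1 := by
  rw [sq]; nth_rewrite 1 [h]
  simp [mul_assoc, hb, mul_reassoc ha]

theorem comm_of_sq_eq_one {a b : D} (ha : a * a = 1) (hb : b * b = 1)
    (h : (a * b) ^ 2 = 1) : a * b = b * a := by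
  have := congrArg (· * (b * a)) h
  simpa [pow_succ, mul_assoc, ha, hb, mul_reassoc ha, mul_reassoc hb] using this

theorem sq_eq_one_of_comm {a b : D} (ha : a * a = 1) (hb : b * b = 1)
    (h : a * b = b * a) : (a * b) ^ 2 = 1 := by
  rw [sq]; nth_rewrite 1 [h]
  simp [mul_assoc, hb, mul_reassoc ha]

/-- Here `a`, `b` play simple roots of type A₂ and `s`, `t` their reflections. Moving `s`, `t` to
the right leaves a(a+b)b and b(a+b)a, both equal to 2(a+b). -/
theorem braid_mul_of_reflection {a b s t : D} (ha : a * a = 2) (hb : b * b = 2)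
    (hst : s * t * s = t * s * t)
    (hsa : s * a = -(a * s)) (htb : t * b = -(b * t)) (hsb : s * b = (a + b) * s)
    (hta : t * a = (a + b) * t) :
    (a * s) * (b * t) * (a * s) = (b * t) * (a * s) * (b * t) := by
  have h1 : (a * s) * (b * t) * (a * s) = a * (a + b) * b * (s * t * s) := by
    simp only [add_mul, mul_add] at hsb hta ⊢
    simp [mul_assoc, mul_reassoc hsa, mul_reassoc hsb, mul_reassoc hta, mul_add, add_mul]
  have h2 : (b * t) * (a * s) * (b * t) = b * (a + b) * a * (t * s * t) := by
    simp only [add_mul, mul_add] at hsb hta ⊢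
    simp [mul_assoc, mul_reassoc htb, mul_reassoc hsb, mul_reassoc hta, mul_add, add_mul]
  rw [h1, h2, hst]
  congr 1
  linear_combination (norm := noncomm_ring) ha * b + a * hb - b * ha - hb * a

/-- Counterpart for the inverse map: separating the factors costs the same sign on both sides, and
xyx = -2(x+y) = yxy. -/
theorem braid_mul_of_anticomm {x y g h : D} (hx : x * x = 2) (hy : y * y = 2)
    (hxy : x * y + y * x = -2) (hgh : g * h * g = h * g * h)
    (hgx : g * x = -(x * g)) (hgy : g * y = -(y * g)) (hhx : h * x = -(x * h))
    (hhy : h * y = -(y * h)) :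
    (x * g) * (y * h) * (x * g) = (y * h) * (x * g) * (y * h) := by
  have h1 : (x * g) * (y * h) * (x * g) = -(x * y * x * (g * h * g)) := by
    simp [mul_assoc, mul_reassoc hgx, mul_reassoc hgy, mul_reassoc hhx]
  have h2 : (y * h) * (x * g) * (y * h) = -(y * x * y * (h * g * h)) := by
    simp [mul_assoc, mul_reassoc hgy, mul_reassoc hhx, mul_reassoc hhy]
  rw [h1, h2, hgh]
  congr 2
  linear_combination (norm := noncomm_ring) hxy * x - y * hx - hxy * y + x * hy

end Ring

/-! ### Relations among the generators of the three algebras -/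

section Relations

variable {n : ℕ}

theorem γ_mul_self (i : Fin n) : γ i * γ i = -1 := by
  simpa only [γ, map_pow, map_neg, map_one, map_mul, sq] using mkA_rel (ARel.sq i)

theorem γ_braid {i j : Fin n} (h : (i : ℕ) + 1 = j) : γ i * γ j * γ i = γ j * γ i * γ j :=
  braid_of_pow_three_eq_neg_one (γ_mul_self i) (γ_mul_self j)
    (by simpa only [γ, map_pow, map_mul, map_neg, map_one] using mkA_rel (ARel.braid i j h))

theorem γ_anticomm {i j : Fin n} (h : (i : ℕ) + 2 ≤ j ∨ (j : ℕ) + 2 ≤ i) :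
    γ i * γ j = -(γ j * γ i) :=
  anticomm_of_sq_eq_neg_one (γ_mul_self i) (γ_mul_self j)
    (by simpa only [γ, map_pow, map_mul, map_neg, map_one] using mkA_rel (ARel.far i j h))

theorem ξ_mul_self (i : Fin n) : ξ i * ξ i = 1 := by rw [← sq, ξ_sq]

theorem τ_zero : τ (0 : Fin (n + 1)) = genB .tau := rfl

theorem τ_succ (i : Fin n) : τ i.succ = σ i * τ i.castSucc * σ i := rfl

theorem σ_mul_self (i : Fin n) : σ i * σ i = 1 := by
  simpa only [σ, genB, map_pow, map_one, map_mul, sq] using mkB_rel (BRel.sigma_sq i)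

theorem σ_braid {i j : Fin n} (h : (i : ℕ) + 1 = j) : σ i * σ j * σ i = σ j * σ i * σ j :=
  braid_of_pow_three_eq_one (σ_mul_self i) (σ_mul_self j)
    (by simpa only [σ, genB, map_pow, map_mul, map_one] using mkB_rel (BRel.braid i j h))

theorem σ_comm {i j : Fin n} (h : (i : ℕ) + 2 ≤ j ∨ (j : ℕ) + 2 ≤ i) : σ i * σ j = σ j * σ i :=
  comm_of_sq_eq_one (σ_mul_self i) (σ_mul_self j)
    (by simpa only [σ, genB, map_pow, map_mul, map_one] using mkB_rel (BRel.far i j h))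

theorem τ_mul_self (i : Fin (n + 1)) : τ i * τ i = 1 := by
  induction i using Fin.induction with
  | zero =>
    simpa only [τ_zero, genB, map_pow, map_one, map_mul, sq] using mkB_rel (BRel.tau_sq (n := n))
  | succ i ih =>
    rw [τ_succ]
    simp [mul_assoc, mul_reassoc (σ_mul_self i), mul_reassoc ih, σ_mul_self]

theorem σ_mul_τ_castSucc (j : Fin n) : σ j * τ j.castSucc = τ j.succ * σ j := by
  rw [τ_succ, mul_assoc _ (σ j), σ_mul_self, mul_one]

theorem σ_mul_τ_succ (j : Fin n) : σ j * τ j.succ = τ j.castSucc * σ j := by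
  rw [τ_succ, mul_assoc, mul_reassoc (σ_mul_self j), one_mul]

theorem σ_comm_τ_of_lt (j : Fin n) (i : Fin (n + 1)) (h : (i : ℕ) < j) :
    σ j * τ i = τ i * σ j := by
  induction i using Fin.induction with
  | zero =>
    refine (comm_of_sq_eq_one (τ_mul_self 0) (σ_mul_self j) ?_).symm
    simpa only [σ, τ_zero, genB, map_pow, map_mul, map_one] using mkB_rel (BRel.tau_sigma j h)
  | succ i ih =>
    rw [Fin.val_succ] at h
    have e := σ_comm (i := j) (j := i) (Or.inr (by omega))
    have e' := ih (by rw [Fin.val_castSucc]; omega)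
    simp only [τ_succ, mul_assoc, mul_reassoc e, mul_reassoc e', e]

/-- The critical case is the index j + 2: the braid relation turns the incoming `σ j` into `σ i`
with i = j + 1, which commutes with the inner `τ j.castSucc`, and a second braid move turns it back.
-/
theorem σ_comm_τ_of_gt (j : Fin n) (i : Fin (n + 1)) (h : (j : ℕ) + 1 < i) :
    σ j * τ i = τ i * σ j := by
  induction i using Fin.induction with
  | zero => simp at h
  | succ i ih =>
    rw [Fin.val_succ] at h
    by_cases hi : (j : ℕ) + 1 = i
    · have hc : i.castSucc = j.succ := by ext; simp [hi]
      have hb := σ_braid hi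
      have ht := σ_comm_τ_of_lt i j.castSucc (by rw [Fin.val_castSucc]; omega)
      rw [τ_succ, hc, τ_succ]
      calc σ j * (σ i * (σ j * τ j.castSucc * σ j) * σ i)
          = (σ j * σ i * σ j) * τ j.castSucc * σ j * σ i := by simp only [mul_assoc]
        _ = σ i * σ j * (σ i * τ j.castSucc) * σ j * σ i := by rw [hb]; simp only [mul_assoc]
        _ = σ i * σ j * τ j.castSucc * (σ i * σ j * σ i) := by rw [ht]; simp only [mul_assoc]
        _ = σ i * (σ j * τ j.castSucc * σ j) * σ i * σ j := by rw [← hb]; simp only [mul_assoc]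
    · have e := σ_comm (i := j) (j := i) (Or.inl (by omega))
      have e' := ih (by rw [Fin.val_castSucc]; omega)
      simp only [τ_succ, mul_assoc, mul_reassoc e, mul_reassoc e', e]

theorem σ_comm_τ (j : Fin n) (i : Fin (n + 1)) (h : i ≠ j.castSucc) (h' : i ≠ j.succ) :
    σ j * τ i = τ i * σ j := by
  rcases lt_or_ge (i : ℕ) j with hl | hl
  · exact σ_comm_τ_of_lt j i hl
  · refine σ_comm_τ_of_gt j i ?_
    rw [Ne, Fin.ext_iff, Fin.val_castSucc] at h
    rw [Ne, Fin.ext_iff, Fin.val_succ] at h'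
    omega

theorem anticomm_conj {D : Type} [Ring D] {s x y x' y' : D} (hs : s * s = 1)
    (hx : s * x = x' * s) (hy : s * y = y' * s) (h : x * y = -(y * x)) : x' * y' = -(y' * x') := by
  have hx' : x' = s * x * s := by rw [hx, mul_assoc, hs, mul_one]
  have hy' : y' = s * y * s := by rw [hy, mul_assoc, hs, mul_one]
  rw [hx', hy']
  simp only [mul_assoc, mul_reassoc hs, one_mul, mul_reassoc h, neg_mul, mul_neg]

/-- Conjugation by the `σ`'s carries the pair of indices (0, 1) to any other pair. -/
theorem τ_anticomm_of_lt (i j : Fin (n + 1)) (h : (i : ℕ) < j) : τ i * τ j = -(τ j * τ i) := by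
  induction i using Fin.induction generalizing j with
  | zero =>
    induction j using Fin.induction with
    | zero => simp at h
    | succ j ih =>
      by_cases hj : (j : ℕ) = 0
      · have hc : j.castSucc = 0 := by ext; simp [hj]
        -- Since j = 0 here, the quartic relation says that the product of the first two `τ`'s
        -- squares to -1.
        have e : (τ 0 * σ j) ^ 4 = -1 := by
          simpa only [σ, τ_zero, genB, map_pow, map_mul, map_one, map_neg]
            using mkB_rel (BRel.tau_sigma_first j hj)
        have e' : (τ 0 * σ j) ^ 4 = τ 0 * τ j.succ * (τ 0 * τ j.succ) := by
          rw [τ_succ, hc]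
          simp only [pow_succ, pow_zero, one_mul, mul_assoc]
        have e'' := congrArg (· * (τ j.succ * τ 0)) (e'.symm.trans e)
        simpa [mul_assoc, τ_mul_self, mul_reassoc (τ_mul_self (n := n) _)] using e''
      · refine anticomm_conj (σ_mul_self j) (σ_comm_τ_of_lt j 0 ?_) (σ_mul_τ_castSucc j) (ih ?_)
        · simpa using Nat.pos_of_ne_zero hj
        · simpa using Nat.pos_of_ne_zero hj
  | succ i ih =>
    rw [Fin.val_succ] at h
    exact anticomm_conj (σ_mul_self i) (σ_mul_τ_castSucc i) (σ_comm_τ_of_gt i j h)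
      (ih j (by rw [Fin.val_castSucc]; omega))

theorem τ_anticomm (i j : Fin (n + 1)) (h : i ≠ j) : τ i * τ j = -(τ j * τ i) := by
  rcases lt_or_gt_of_ne (Fin.val_ne_of_ne h) with hl | hl
  · exact τ_anticomm_of_lt i j hl
  · rw [τ_anticomm_of_lt j i hl, neg_neg]

end Relations

/-! ### Root vectors in a Clifford family -/

section Roots

/-- The difference of two consecutive members of a family. -/
def consecDiff {D : Type} [Ring D] {n : ℕ} (e : Fin (n + 1) → D) (j : Fin n) : D :=
  e j.castSucc - e j.succ

variable {D : Type} [Ring D] {n : ℕ} {e : Fin (n + 1) → D}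

theorem consecDiff_mul_self (he : ∀ i, e i * e i = 1) (hee : ∀ i j, i ≠ j → e i * e j = -(e j * e i))
    (j : Fin n) : consecDiff e j * consecDiff e j = 2 := by
  have h := hee _ _ (Fin.castSucc_lt_succ (i := j)).ne
  simp only [consecDiff, sub_mul, mul_sub, he, h]
  abel_nf
  simp

/-- Only the shared vector `e i.succ` survives; it enters the two differences with opposite signs.
-/
theorem consecDiff_add_swap (he : ∀ i, e i * e i = 1)
    (hee : ∀ i j, i ≠ j → e i * e j = -(e j * e i)) {i j : Fin n} (h : (i : ℕ) + 1 = j) :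
    consecDiff e i * consecDiff e j + consecDiff e j * consecDiff e i = -2 := by
  have hc : j.castSucc = i.succ := by ext; simp [← h]
  have h₁ := hee i.castSucc i.succ (Fin.castSucc_lt_succ (i := i)).ne
  have h₂ := hee i.castSucc j.succ (by rw [Ne, Fin.ext_iff]; simp; omega)
  have h₃ := hee i.succ j.succ (by rw [Ne, Fin.ext_iff]; simp; omega)
  simp only [consecDiff, hc, sub_mul, mul_sub, he, h₁, h₂, h₃]
  abel_nf
  simp

theorem consecDiff_anticomm (hee : ∀ i j, i ≠ j → e i * e j = -(e j * e i)) {i j : Fin n}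
    (h : (i : ℕ) + 2 ≤ j ∨ (j : ℕ) + 2 ≤ i) :
    consecDiff e i * consecDiff e j = -(consecDiff e j * consecDiff e i) := by
  have h₁ := hee i.castSucc j.castSucc (by rw [Ne, Fin.ext_iff]; simp; omega)
  have h₂ := hee i.castSucc j.succ (by rw [Ne, Fin.ext_iff]; simp; omega)
  have h₃ := hee i.succ j.castSucc (by rw [Ne, Fin.ext_iff]; simp; omega)
  have h₄ := hee i.succ j.succ (by rw [Ne, Fin.ext_iff]; simp; omega)
  simp only [consecDiff, sub_mul, mul_sub, h₁, h₂, h₃, h₄]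
  abel

theorem consecDiff_anticomm_of_ne (hee : ∀ i j, i ≠ j → e i * e j = -(e j * e i)) {i : Fin (n + 1)}
    {j : Fin n} (h : i ≠ j.castSucc) (h' : i ≠ j.succ) :
    consecDiff e j * e i = -(e i * consecDiff e j) := by
  simp only [consecDiff, sub_mul, mul_sub, hee _ _ h.symm, hee _ _ h'.symm]
  abel

theorem mul_consecDiff_of_anticomm {g : D} (hg : ∀ i, g * e i = -(e i * g)) (j : Fin n) :
    g * consecDiff e j = -(consecDiff e j * g) := by
  simp only [consecDiff, sub_mul, mul_sub, hg]
  abel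

end Roots

/-! ### The normalization 1/√2 -/

section Scale

variable {D : Type} [Ring D] [Algebra ℂ D]

theorem inv_sqrt_two_mul_self : ((Real.sqrt 2 : ℂ))⁻¹ * ((Real.sqrt 2 : ℂ))⁻¹ = 2⁻¹ := by
  rw [← mul_inv, ← Complex.ofReal_mul, Real.mul_self_sqrt (by norm_num)]
  norm_num

theorem inv_sqrt_two_smul_two :
    ((Real.sqrt 2 : ℂ))⁻¹ • ((Real.sqrt 2 : ℂ))⁻¹ • (2 : D) = 1 := by
  rw [smul_smul, inv_sqrt_two_mul_self, ← map_ofNat (algebraMap ℂ D) 2, Algebra.smul_def, ← map_mul]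
  norm_num

variable {a b : D}

theorem scaled_braid (c : ℂ) (h : a * b * a = b * a * b) :
    (c • a) * (c • b) * (c • a) = (c • b) * (c • a) * (c • b) := by
  simp only [smul_mul_assoc, mul_smul_comm, h]

theorem scaled_mul (c : ℂ) : (c • a) * (c • b) = c • c • (a * b) := by
  simp only [smul_mul_assoc, mul_smul_comm]

end Scale

/-! ### The homomorphism from the supertensor product to `𝓑` -/

section Forward

variable {n : ℕ}

/-- The elements of `𝓑` corresponding to the generators of `𝓐`. -/
def twistB (j : Fin n) : BAlg n :=
  ((Real.sqrt 2 : ℂ))⁻¹ • ((τ j.castSucc - τ j.succ) * σ j)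

theorem twistB_eq (j : Fin n) :
    twistB j = ((Real.sqrt 2 : ℂ))⁻¹ • (consecDiff (τ (n := n)) j * σ j) := rfl

theorem σ_mul_diff (j : Fin n) :
    σ j * consecDiff (τ (n := n)) j = -(consecDiff (τ (n := n)) j * σ j) := by
  simp only [consecDiff, sub_mul, mul_sub, σ_mul_τ_castSucc, σ_mul_τ_succ]
  abel

theorem twistB_mul_self (j : Fin n) : twistB j * twistB j = -1 := by
  rw [twistB_eq, scaled_mul, mul_assoc, mul_reassoc (σ_mul_diff j), neg_mul, mul_neg, mul_assoc,
    σ_mul_self, mul_one, consecDiff_mul_self τ_mul_self τ_anticomm, smul_neg, smul_neg,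
    inv_sqrt_two_smul_two]

theorem twistB_braid {i j : Fin n} (h : (i : ℕ) + 1 = j) :
    twistB i * twistB j * twistB i = twistB j * twistB i * twistB j := by
  have hc : j.castSucc = i.succ := by ext; simp [← h]
  have h₁ := σ_comm_τ i j.succ (by rw [Ne, Fin.ext_iff]; simp; omega)
    (by rw [Ne, Fin.ext_iff]; simp; omega)
  have h₂ := σ_comm_τ j i.castSucc (by rw [Ne, Fin.ext_iff]; simp; omega)
    (by rw [Ne, Fin.ext_iff]; simp; omega)
  have h₃ := σ_mul_τ_succ i
  have h₄ := σ_mul_τ_castSucc j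
  refine scaled_braid _ (braid_mul_of_reflection (consecDiff_mul_self τ_mul_self τ_anticomm i)
    (consecDiff_mul_self τ_mul_self τ_anticomm j) (σ_braid h) (σ_mul_diff i) (σ_mul_diff j) ?_ ?_)
  · simp only [hc, mul_sub, h₁, h₃, sub_add_sub_cancel, sub_mul]
  · rw [hc] at h₄
    simp only [hc, mul_sub, h₂, h₄, sub_add_sub_cancel, sub_mul]

theorem σ_comm_diff {i j : Fin n} (h : (i : ℕ) + 2 ≤ j ∨ (j : ℕ) + 2 ≤ i) :
    σ i * consecDiff (τ (n := n)) j = consecDiff (τ (n := n)) j * σ i := by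
  have h₁ := σ_comm_τ i j.succ (by rw [Ne, Fin.ext_iff]; simp; omega)
    (by rw [Ne, Fin.ext_iff]; simp; omega)
  have h₂ := σ_comm_τ i j.castSucc (by rw [Ne, Fin.ext_iff]; simp; omega)
    (by rw [Ne, Fin.ext_iff]; simp; omega)
  simp only [consecDiff, mul_sub, h₁, h₂, sub_mul]

theorem twistB_anticomm {i j : Fin n} (h : (i : ℕ) + 2 ≤ j ∨ (j : ℕ) + 2 ≤ i) :
    twistB i * twistB j = -(twistB j * twistB i) := by
  simp only [twistB_eq, scaled_mul, mul_assoc, mul_reassoc (σ_comm_diff h),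
    mul_reassoc (σ_comm_diff h.symm), mul_reassoc (consecDiff_anticomm τ_anticomm h), σ_comm h,
    neg_mul, smul_neg]

/-- `σ j` swaps the two neighbouring `τ`'s; the root vector swaps them back with a sign. Any other
`τ i` commutes with `σ j` and anticommutes with the root vector. -/
theorem twistB_mul_τ (j : Fin n) (i : Fin (n + 1)) : twistB j * τ i = -(τ i * twistB j) := by
  rw [twistB_eq, smul_mul_assoc, mul_smul_comm, ← smul_neg]
  congr 1
  by_cases h : i = j.castSucc
  · subst h
    rw [mul_assoc, σ_mul_τ_castSucc]
    simp only [consecDiff, ← mul_assoc, sub_mul, mul_sub, τ_mul_self]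
    abel
  by_cases h' : i = j.succ
  · subst h'
    rw [mul_assoc, σ_mul_τ_succ]
    simp only [consecDiff, ← mul_assoc, sub_mul, mul_sub, τ_mul_self]
    abel
  rw [mul_assoc, σ_comm_τ j i h h', ← mul_assoc, consecDiff_anticomm_of_ne τ_anticomm h h', neg_mul,
    mul_assoc]

/-- The homomorphism `𝓐 → 𝓑`. -/
def fromA (n : ℕ) : AAlg n →ₐ[ℂ] BAlg n :=
  liftA (FreeAlgebra.lift ℂ twistB) (by
    intro x y h
    cases h with
    | sq i =>
      simp only [map_neg, map_one, map_mul, FreeAlgebra.lift_ι_apply, sq, twistB_mul_self]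
    | braid i j h =>
      simp only [map_pow, map_mul, map_neg, map_one, FreeAlgebra.lift_ι_apply]
      exact pow_three_eq_neg_one_of_braid (twistB_mul_self i) (twistB_mul_self j) (twistB_braid h)
    | far i j h =>
      simp only [map_pow, map_mul, map_neg, map_one, FreeAlgebra.lift_ι_apply]
      exact sq_eq_neg_one_of_anticomm (twistB_mul_self i) (twistB_mul_self j) (twistB_anticomm h))

theorem fromA_γ (j : Fin n) : fromA n (γ j) = twistB j :=
  (liftA_mkA _ _ _).trans (FreeAlgebra.lift_ι_apply _ _)

theorem sum_smul_mul_self {D : Type} [Ring D] [Algebra ℂ D] {k : ℕ} {e : Fin k → D}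
    (he : ∀ i, e i * e i = 1) (hee : ∀ i j, i ≠ j → e i * e j = -(e j * e i)) (v : Fin k → ℂ) :
    (∑ i, v i • e i) * (∑ i, v i • e i) = algebraMap ℂ D (sumSq k v) := by
  have hpair : ∀ i j, e i * e j + e j * e i = if i = j then 2 else 0 := by
    intro i j
    split_ifs with h
    · rw [h, he]; norm_num
    · rw [hee i j h, neg_add_cancel]
  have h₁ : (∑ i, v i • e i) * (∑ i, v i • e i) = ∑ i, ∑ j, (v i * v j) • (e i * e j) := by
    simp only [Finset.sum_mul_sum, smul_mul_smul_comm]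
  have h₂ : (∑ i, v i • e i) * (∑ i, v i • e i) = ∑ i, ∑ j, (v i * v j) • (e j * e i) := by
    rw [h₁, Finset.sum_comm]
    simp only [mul_comm (v _) (v _)]
  -- Doubling symmetrizes the double sum, so only the anticommutators `hpair` enter.
  have h₃ : (2 : ℂ) • ((∑ i, v i • e i) * (∑ i, v i • e i)) =
      (2 : ℂ) • algebraMap ℂ D (sumSq k v) := by
    rw [two_smul]
    nth_rewrite 1 [h₁]
    rw [h₂]
    simp only [← Finset.sum_add_distrib, ← smul_add, hpair]
    simp only [smul_ite, smul_zero, Finset.sum_ite_eq, Finset.mem_univ, if_true, sumSq,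
      QuadraticMap.weightedSumSquares_apply, map_sum, Finset.smul_sum]
    refine Finset.sum_congr rfl fun i _ => ?_
    rw [← map_ofNat (algebraMap ℂ D) 2, Algebra.smul_def, Algebra.smul_def, ← map_mul, ← map_mul]
    simp [mul_comm]
  exact smul_right_injective D (two_ne_zero (α := ℂ)) h₃

/-- A family of anticommuting involutions defines a homomorphism from the Clifford algebra. -/
def cliffordLift {D : Type} [Ring D] [Algebra ℂ D] {k : ℕ} (e : Fin k → D)
    (he : ∀ i, e i * e i = 1) (hee : ∀ i j, i ≠ j → e i * e j = -(e j * e i)) : CAlg k →ₐ[ℂ] D :=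
  CliffordAlgebra.lift (sumSq k)
    ⟨Fintype.linearCombination ℂ e, fun v => by
      simpa only [Fintype.linearCombination_apply] using sum_smul_mul_self he hee v⟩

theorem cliffordLift_ξ {D : Type} [Ring D] [Algebra ℂ D] {k : ℕ} (e : Fin k → D)
    (he : ∀ i, e i * e i = 1) (hee : ∀ i j, i ≠ j → e i * e j = -(e j * e i)) (i : Fin k) :
    cliffordLift e he hee (ξ i) = e i := by
  rw [cliffordLift, ξ, CliffordAlgebra.lift_ι_apply, Fintype.linearCombination_apply_single,
    one_smul]

/-- The homomorphism `𝓒 → 𝓑`. -/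
def fromC (n : ℕ) : CAlg (n + 1) →ₐ[ℂ] BAlg n :=
  cliffordLift τ τ_mul_self τ_anticomm

theorem fromC_ξ (i : Fin (n + 1)) : fromC n (ξ i) = τ i := cliffordLift_ξ _ _ _ i

/-- The homomorphism `𝓒 ⊗ 𝓐 → 𝓑`. -/
def toB (n : ℕ) : gradC (n + 1) ᵍ⊗[ℂ] gradA n →ₐ[ℂ] BAlg n :=
  GradedTensorProduct.lift _ _ (fromC n) (fromA n) fun _ _ a b =>
    wordGrading_supercommute ξ (fun _ => 1) γ (fun _ => 1) (fromC n) (fromA n)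
      (fun x y => by
        rw [fromC_ξ, fromA_γ, twistB_mul_τ, mul_one, uzpow_one, Units.neg_smul, one_smul, neg_neg])
      (gradC_le_wordGrading a.2) b.2

theorem toB_left (i : Fin (n + 1)) : toB n (ξ i ᵍ⊗ₜ[ℂ] (1 : AAlg n)) = τ i := by
  rw [toB, GradedTensorProduct.lift_tmul, map_one, mul_one, fromC_ξ]

theorem toB_right (j : Fin n) : toB n ((1 : CAlg (n + 1)) ᵍ⊗ₜ[ℂ] γ j) = twistB j := by
  rw [toB, GradedTensorProduct.lift_tmul, map_one, one_mul, fromA_γ]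

end Forward

/-! ### The inverse homomorphism from `𝓑` -/

section Backward

variable {n : ℕ}

section Abstract

variable {D : Type} [Ring D] [Algebra ℂ D] {e : Fin (n + 1) → D} {g : Fin n → D}

/-- The products of the differences `e j - e (j + 1)`, normalized, with the elements `g j`. -/
def reflProd (e : Fin (n + 1) → D) (g : Fin n → D) (j : Fin n) : D :=
  ((Real.sqrt 2 : ℂ))⁻¹ • (consecDiff e j * g j)

theorem reflProd_mul_self (he : ∀ i, e i * e i = 1) (hee : ∀ i j, i ≠ j → e i * e j = -(e j * e i))
    (hg : ∀ j, g j * g j = -1) (hge : ∀ j i, g j * e i = -(e i * g j)) (j : Fin n) :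
    reflProd e g j * reflProd e g j = 1 := by
  rw [reflProd, scaled_mul, mul_assoc, mul_reassoc (mul_consecDiff_of_anticomm (hge j) j), neg_mul,
    mul_neg, mul_assoc, hg, mul_neg_one, mul_neg, neg_neg, consecDiff_mul_self he hee,
    inv_sqrt_two_smul_two]

theorem reflProd_braid (he : ∀ i, e i * e i = 1) (hee : ∀ i j, i ≠ j → e i * e j = -(e j * e i))
    (hge : ∀ j i, g j * e i = -(e i * g j)) {i j : Fin n} (h : (i : ℕ) + 1 = j)
    (hb : g i * g j * g i = g j * g i * g j) :
    reflProd e g i * reflProd e g j * reflProd e g i =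
      reflProd e g j * reflProd e g i * reflProd e g j :=
  scaled_braid _ (braid_mul_of_anticomm (consecDiff_mul_self he hee i) (consecDiff_mul_self he hee j)
    (consecDiff_add_swap he hee h) hb (mul_consecDiff_of_anticomm (hge i) i)
    (mul_consecDiff_of_anticomm (hge i) j) (mul_consecDiff_of_anticomm (hge j) i)
    (mul_consecDiff_of_anticomm (hge j) j))

theorem reflProd_comm (hee : ∀ i j, i ≠ j → e i * e j = -(e j * e i))
    (hge : ∀ j i, g j * e i = -(e i * g j)) {i j : Fin n}
    (h : (i : ℕ) + 2 ≤ j ∨ (j : ℕ) + 2 ≤ i) (hb : g i * g j = -(g j * g i)) :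
    reflProd e g i * reflProd e g j = reflProd e g j * reflProd e g i := by
  simp only [reflProd, scaled_mul, mul_assoc, mul_reassoc (mul_consecDiff_of_anticomm (hge i) j),
    mul_reassoc (mul_consecDiff_of_anticomm (hge j) i), mul_reassoc (consecDiff_anticomm hee h), hb,
    neg_mul, mul_neg, neg_neg]

theorem reflProd_mul_of_ne (hee : ∀ i j, i ≠ j → e i * e j = -(e j * e i))
    (hge : ∀ j i, g j * e i = -(e i * g j)) {i : Fin (n + 1)} {j : Fin n}
    (h : i ≠ j.castSucc) (h' : i ≠ j.succ) : reflProd e g j * e i = e i * reflProd e g j := by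
  simp only [reflProd, smul_mul_assoc, mul_smul_comm, mul_assoc, hge,
    mul_reassoc (consecDiff_anticomm_of_ne hee h h'), neg_mul, mul_neg, neg_neg]

/-- The root vector carries `e j.castSucc` to `-e j.succ`, and passing `g j` supplies the second
sign. -/
theorem reflProd_mul_castSucc (he : ∀ i, e i * e i = 1)
    (hge : ∀ j i, g j * e i = -(e i * g j)) (j : Fin n) :
    reflProd e g j * e j.castSucc = e j.succ * reflProd e g j := by
  simp only [reflProd, smul_mul_assoc, mul_smul_comm]
  congr 1
  rw [mul_assoc, hge, mul_neg, ← mul_assoc, ← mul_assoc, ← neg_mul]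
  congr 1
  simp only [consecDiff, sub_mul, mul_sub, he]
  abel

theorem reflProd_conj (he : ∀ i, e i * e i = 1) (hee : ∀ i j, i ≠ j → e i * e j = -(e j * e i))
    (hg : ∀ j, g j * g j = -1) (hge : ∀ j i, g j * e i = -(e i * g j)) (j : Fin n) :
    reflProd e g j * e j.castSucc * reflProd e g j = e j.succ := by
  rw [reflProd_mul_castSucc he hge, mul_assoc, reflProd_mul_self he hee hg hge, mul_one]

/-- Anticommuting involutions and generators of `𝓐` anticommuting with them define a homomorphism
from `𝓑`. -/
def reflLift (e : Fin (n + 1) → D) (g : Fin n → D)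
    (he : ∀ i, e i * e i = 1) (hee : ∀ i j, i ≠ j → e i * e j = -(e j * e i))
    (hg : ∀ j, g j * g j = -1) (hge : ∀ j i, g j * e i = -(e i * g j))
    (hb : ∀ i j : Fin n, (i : ℕ) + 1 = j → g i * g j * g i = g j * g i * g j)
    (hf : ∀ i j : Fin n, ((i : ℕ) + 2 ≤ j ∨ (j : ℕ) + 2 ≤ i) → g i * g j = -(g j * g i)) :
    BAlg n →ₐ[ℂ] D :=
  liftB (FreeAlgebra.lift ℂ fun x => BGen.casesOn x (e 0) (reflProd e g)) (by
    have hs := reflProd_mul_self he hee hg hge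
    intro x y h
    cases h with
    | tau_sq => simp only [map_one, map_mul, FreeAlgebra.lift_ι_apply, sq, he]
    | sigma_sq i => simp only [map_one, map_mul, FreeAlgebra.lift_ι_apply, sq, hs]
    | braid i j h =>
      simp only [map_pow, map_mul, map_one, FreeAlgebra.lift_ι_apply]
      exact pow_three_eq_one_of_braid (hs i) (hs j) (reflProd_braid he hee hge h (hb i j h))
    | far i j h =>
      simp only [map_pow, map_mul, map_one, FreeAlgebra.lift_ι_apply]
      exact sq_eq_one_of_comm (hs i) (hs j) (reflProd_comm hee hge h (hf i j h))
    | tau_sigma i h =>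
      simp only [map_pow, map_mul, map_one, FreeAlgebra.lift_ι_apply]
      refine sq_eq_one_of_comm (he 0) (hs i) (reflProd_mul_of_ne hee hge ?_ ?_).symm
      · rw [Ne, Fin.ext_iff, Fin.val_castSucc, Fin.val_zero]; omega
      · exact (Fin.succ_ne_zero i).symm
    | tau_sigma_first i h =>
      simp only [map_pow, map_mul, map_one, map_neg, FreeAlgebra.lift_ι_apply]
      have hc : i.castSucc = 0 := by ext; simp [h]
      have hconj := reflProd_conj he hee hg hge i
      rw [hc] at hconj
      -- Regrouped, the fourth power is the square of `e 0 * e i.succ`, a product of two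
      -- anticommuting involutions.
      have e₁ : (e 0 * reflProd e g i) ^ 4 = e 0 * (reflProd e g i * e 0 * reflProd e g i) *
          (e 0 * (reflProd e g i * e 0 * reflProd e g i)) := by
        simp only [pow_succ, pow_zero, one_mul, mul_assoc]
      rw [e₁, hconj]
      simp only [mul_assoc, mul_reassoc (hee _ _ (Fin.succ_ne_zero i)), neg_mul, mul_neg, he,
        mul_one])

variable (he : ∀ i, e i * e i = 1) (hee : ∀ i j, i ≠ j → e i * e j = -(e j * e i))
    (hg : ∀ j, g j * g j = -1) (hge : ∀ j i, g j * e i = -(e i * g j))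
    (hb : ∀ i j : Fin n, (i : ℕ) + 1 = j → g i * g j * g i = g j * g i * g j)
    (hf : ∀ i j : Fin n, ((i : ℕ) + 2 ≤ j ∨ (j : ℕ) + 2 ≤ i) → g i * g j = -(g j * g i))

theorem reflLift_tau : reflLift e g he hee hg hge hb hf (genB .tau) = e 0 :=
  (liftB_mkB _ _ _).trans (FreeAlgebra.lift_ι_apply _ _)

theorem reflLift_σ (j : Fin n) : reflLift e g he hee hg hge hb hf (σ j) = reflProd e g j :=
  (liftB_mkB _ _ _).trans (FreeAlgebra.lift_ι_apply _ _)

theorem reflLift_τ (i : Fin (n + 1)) : reflLift e g he hee hg hge hb hf (τ i) = e i := by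
  induction i using Fin.induction with
  | zero => exact reflLift_tau he hee hg hge hb hf
  | succ i ih =>
    rw [τ_succ, map_mul, map_mul, reflLift_σ, ih, reflProd_conj he hee hg hge]

/-- The root vector now occurs twice, and its square 2 cancels the two factors 1/√2. -/
theorem reflLift_twistB (j : Fin n) : reflLift e g he hee hg hge hb hf (twistB j) = g j := by
  rw [twistB, map_smul, map_mul, map_sub, reflLift_σ, reflLift_τ, reflLift_τ, reflProd,
    mul_smul_comm, ← mul_assoc]
  change _ • _ • (consecDiff e j * consecDiff e j * g j) = _
  rw [consecDiff_mul_self he hee, ← smul_mul_assoc, ← smul_mul_assoc, inv_sqrt_two_smul_two,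
    one_mul]

end Abstract

local notation "T" => gradC (n + 1) ᵍ⊗[ℂ] gradA n

/-- The generators of `𝓒` in the supertensor product. -/
def ξT (i : Fin (n + 1)) : T := ξ i ᵍ⊗ₜ[ℂ] (1 : AAlg n)

/-- The generators of `𝓐` in the supertensor product. -/
def γT (j : Fin n) : T := (1 : CAlg (n + 1)) ᵍ⊗ₜ[ℂ] γ j

theorem includeLeft_ξ (i : Fin (n + 1)) :
    GradedTensorProduct.includeLeft (gradC (n + 1)) (gradA n) (ξ i) = ξT i := rfl

theorem includeRight_γ (j : Fin n) :
    GradedTensorProduct.includeRight (gradC (n + 1)) (gradA n) (γ j) = γT j := rfl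

theorem ξ_mem (i : Fin (n + 1)) : ξ i ∈ gradC (n + 1) 1 :=
  CliffordAlgebra.ι_mem_evenOdd_one _ _

theorem γ_mem (j : Fin n) : γ j ∈ gradA n 1 := gen_mem_wordGrading γ (fun _ => 1) j

/-- This is the sign rule of the supertensor product for two odd factors. -/
theorem γT_mul_ξT (j : Fin n) (i : Fin (n + 1)) : γT j * ξT i = -((ξT i * γT j : T)) := by
  have h := GradedTensorProduct.tmul_coe_mul_coe_tmul (R := ℂ) (gradC (n + 1)) (gradA n)
    1 ⟨γ j, γ_mem j⟩ ⟨ξ i, ξ_mem i⟩ 1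
  have h' := GradedTensorProduct.tmul_one_mul_one_tmul (R := ℂ) (gradC (n + 1)) (gradA n)
    (ξ i) (γ j)
  simp only [one_mul, mul_one, uzpow_one, Units.neg_smul, one_smul] at h h'
  rw [γT, ξT, h, h']

/-- The homomorphism `𝓑 → 𝓒 ⊗ 𝓐`. -/
def fromB (n : ℕ) : BAlg n →ₐ[ℂ] gradC (n + 1) ᵍ⊗[ℂ] gradA n :=
  reflLift ξT γT
    (fun i => by rw [← includeLeft_ξ, ← map_mul, ξ_mul_self, map_one])
    (fun i j h => by rw [← includeLeft_ξ, ← includeLeft_ξ, ← map_mul, ξ_mul_ξ h, map_neg, map_mul])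
    (fun j => by rw [← includeRight_γ, ← map_mul, γ_mul_self, map_neg, map_one])
    γT_mul_ξT
    (fun i j h => by simp only [← includeRight_γ, ← map_mul, γ_braid h])
    (fun i j h => by simp only [← includeRight_γ, ← map_mul, γ_anticomm h, map_neg])

theorem fromB_tau : fromB n (genB .tau) = ξT 0 := reflLift_tau _ _ _ _ _ _
theorem fromB_σ (j : Fin n) : fromB n (σ j) = reflProd ξT γT j := reflLift_σ _ _ _ _ _ _ j
theorem fromB_τ (i : Fin (n + 1)) : fromB n (τ i) = ξT i := reflLift_τ _ _ _ _ _ _ i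
theorem fromB_twistB (j : Fin n) : fromB n (twistB j) = γT j := reflLift_twistB _ _ _ _ _ _ j

/-! ### The two homomorphisms are mutually inverse -/

theorem toB_ξT (i : Fin (n + 1)) : toB n (ξT i) = τ i := toB_left i
theorem toB_γT (j : Fin n) : toB n (γT j) = twistB j := toB_right j

/-- Homomorphisms from `𝓒 ⊗ 𝓐` are determined by their values on the generators. -/
theorem tensor_algHom_ext {D : Type} [Ring D] [Algebra ℂ D] {φ ψ : T →ₐ[ℂ] D}
    (hξ : ∀ i, φ (ξT i) = ψ (ξT i)) (hγ : ∀ j, φ (γT j) = ψ (γT j)) : φ = ψ := by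
  apply GradedTensorProduct.algHom_ext
  · apply CliffordAlgebra.hom_ext
    apply LinearMap.pi_ext'
    intro i
    ext
    exact hξ i
  · refine AlgHom.ext_of_adjoin_eq_top (adjoin_range_mkAlgHom (ARel n)) ?_
    rintro _ ⟨j, rfl⟩
    exact hγ j

theorem BAlg_algHom_ext {D : Type} [Ring D] [Algebra ℂ D] {φ ψ : BAlg n →ₐ[ℂ] D}
    (h : ∀ x, φ (genB x) = ψ (genB x)) : φ = ψ := by
  refine AlgHom.ext_of_adjoin_eq_top (adjoin_range_mkAlgHom (BRel n)) ?_
  rintro _ ⟨j, rfl⟩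
  exact h j

theorem toB_comp_fromB : (toB n).comp (fromB n) = AlgHom.id ℂ (BAlg n) := by
  refine BAlg_algHom_ext fun x => ?_
  cases x with
  | tau => rw [AlgHom.comp_apply, fromB_tau, toB_ξT]; rfl
  | sigma j =>
    change toB n (fromB n (σ j)) = σ j
    rw [fromB_σ, reflProd, consecDiff, map_smul, map_mul, map_sub, toB_ξT, toB_ξT, toB_γT, twistB,
      mul_smul_comm, ← mul_assoc]
    change _ • _ • (consecDiff τ j * consecDiff τ j * σ j) = _
    rw [consecDiff_mul_self τ_mul_self τ_anticomm, ← smul_mul_assoc, ← smul_mul_assoc,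
      inv_sqrt_two_smul_two, one_mul]

theorem fromB_comp_toB : (fromB n).comp (toB n) = AlgHom.id ℂ T := by
  refine tensor_algHom_ext (fun i => ?_) (fun j => ?_)
  · rw [AlgHom.comp_apply, toB_ξT, fromB_τ]; rfl
  · rw [AlgHom.comp_apply, toB_γT, fromB_twistB]; rfl

/-- The isomorphism `𝓒 ⊗ 𝓐 ≃ 𝓑`. -/
def tensorEquiv (n : ℕ) : gradC (n + 1) ᵍ⊗[ℂ] gradA n ≃ₐ[ℂ] BAlg n :=
  AlgEquiv.ofAlgHom (toB n) (fromB n) toB_comp_fromB fromB_comp_toB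

/-! ### Compatibility with the gradings -/

theorem genB_mem (x : BGen n) : genB x ∈ gradB n (degB x) := gen_mem_wordGrading genB degB x

theorem τ_mem (i : Fin (n + 1)) : τ i ∈ gradB n 1 := by
  induction i using Fin.induction with
  | zero => exact genB_mem .tau
  | succ i ih =>
    rw [τ_succ]
    exact SetLike.mul_mem_graded (A := gradB n) (i := 0 + 1) (j := 0)
      (SetLike.mul_mem_graded (i := 0) (j := 1) (genB_mem (.sigma i)) ih) (genB_mem (.sigma i))

theorem twistB_mem (j : Fin n) : twistB j ∈ gradB n 1 := by
  exact Submodule.smul_mem _ _ (SetLike.mul_mem_graded (A := gradB n) (i := 1) (j := 0)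
    (sub_mem (τ_mem _) (τ_mem _)) (genB_mem (.sigma j)))

theorem toB_mem {α : ZMod 2} {x : T} (hx : x ∈ superTensorGrading (gradC (n + 1)) (gradA n) α) :
    toB n x ∈ gradB n α := by
  refine (Submodule.span_le (p := (gradB n α).comap (toB n).toLinearMap)).2 ?_ hx
  rintro _ ⟨β, δ, rfl, a, ha, b, hb, rfl⟩
  change fromC n a * fromA n b ∈ gradB n (β + δ)
  refine SetLike.mul_mem_graded ?_ ?_
  · exact map_wordGrading_le ξ (fun _ => 1) (fromC n) (gradB n)
      (fun i => by rw [fromC_ξ]; exact τ_mem i) (gradC_le_wordGrading ha)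
  · exact map_wordGrading_le γ (fun _ => 1) (fromA n) (gradB n)
      (fun i => by rw [fromA_γ]; exact twistB_mem i) hb

theorem ξT_mem (i : Fin (n + 1)) : ξT i ∈ superTensorGrading (gradC (n + 1)) (gradA n) 1 :=
  Submodule.subset_span ⟨1, 0, add_zero _, ξ i, ξ_mem i, 1,
    SetLike.GradedOne.one_mem (A := gradA n), rfl⟩

theorem γT_mem (j : Fin n) : γT j ∈ superTensorGrading (gradC (n + 1)) (gradA n) 1 :=
  Submodule.subset_span ⟨0, 1, zero_add _, 1,
    SetLike.GradedOne.one_mem (A := gradC (n + 1)), γ j, γ_mem j, rfl⟩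

theorem fromB_mem {α : ZMod 2} {b : BAlg n} (hb : b ∈ gradB n α) :
    fromB n b ∈ superTensorGrading (gradC (n + 1)) (gradA n) α := by
  have := superTensorGrading_gradedMonoid (gradC (n + 1)) (gradA n)
  refine map_wordGrading_le genB degB (fromB n) _ (fun x => ?_) hb
  cases x with
  | tau => rw [fromB_tau]; exact ξT_mem 0
  | sigma j =>
    -- The even degree 0 is written as 1 + 1 in ℤ/2 because the image of `σ j` is a product of two
    -- odd elements.
    change fromB n (σ j) ∈ superTensorGrading (gradC (n + 1)) (gradA n) (1 + 1)
    rw [fromB_σ]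
    exact Submodule.smul_mem _ _
      (SetLike.mul_mem_graded (sub_mem (ξT_mem _) (ξT_mem _)) (γT_mem j))

end Backward

end TwistedDuality

end

/-- With `k = n + 1`, so that `k` runs through all integers `k ≥ 1`: there is exactly one algebra
homomorphism from `𝓒_k ⊗ 𝓐_k` (supertensor product) to `𝓑_k` with the prescribed values on the
generators, and it is an isomorphism of superalgebras. -/
theorem theorem3p2 (n : ℕ) :
    ∃ ϑ : (TwistedDuality.gradC (n + 1) ᵍ⊗[ℂ] TwistedDuality.gradA n) ≃ₐ[ℂ]
        TwistedDuality.BAlg n,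
      (∀ α : ZMod 2,
        Submodule.map ϑ.toLinearMap
            (TwistedDuality.superTensorGrading
              (TwistedDuality.gradC (n + 1)) (TwistedDuality.gradA n) α) =
          TwistedDuality.gradB n α) ∧
      (∀ i : Fin (n + 1),
        ϑ (TwistedDuality.ξ i ᵍ⊗ₜ[ℂ] (1 : TwistedDuality.AAlg n)) = TwistedDuality.τ i) ∧
      (∀ j : Fin n,
        ϑ ((1 : TwistedDuality.CAlg (n + 1)) ᵍ⊗ₜ[ℂ] TwistedDuality.γ j) =
          ((Real.sqrt 2 : ℂ))⁻¹ •
            ((TwistedDuality.τ j.castSucc - TwistedDuality.τ j.succ) * TwistedDuality.σ j)) ∧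
      (∀ φ : (TwistedDuality.gradC (n + 1) ᵍ⊗[ℂ] TwistedDuality.gradA n) →ₐ[ℂ]
          TwistedDuality.BAlg n,
        (∀ i : Fin (n + 1),
          φ (TwistedDuality.ξ i ᵍ⊗ₜ[ℂ] (1 : TwistedDuality.AAlg n)) = TwistedDuality.τ i) →
        (∀ j : Fin n,
          φ ((1 : TwistedDuality.CAlg (n + 1)) ᵍ⊗ₜ[ℂ] TwistedDuality.γ j) =
            ((Real.sqrt 2 : ℂ))⁻¹ •
              ((TwistedDuality.τ j.castSucc - TwistedDuality.τ j.succ) *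
                TwistedDuality.σ j)) →
        φ = (ϑ : (TwistedDuality.gradC (n + 1) ᵍ⊗[ℂ] TwistedDuality.gradA n) →ₐ[ℂ]
          TwistedDuality.BAlg n)) := by
  refine ⟨TwistedDuality.tensorEquiv n, fun α => le_antisymm ?_ ?_, TwistedDuality.toB_left,
    TwistedDuality.toB_right, fun φ hξ hγ => ?_⟩
  · rintro _ ⟨x, hx, rfl⟩
    exact TwistedDuality.toB_mem hx
  · intro b hb
    exact ⟨TwistedDuality.fromB n b, TwistedDuality.fromB_mem hb,
      DFunLike.congr_fun TwistedDuality.toB_comp_fromB b⟩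
  · exact TwistedDuality.tensor_algHom_ext
      (fun i => (hξ i).trans (TwistedDuality.toB_left i).symm)
      (fun j => (hγ j).trans (TwistedDuality.toB_right j).symm)
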